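/- Let $p$ be a prime and let $K_\infty$ be a deeply ramified algebraic extension of $\mathbf{Q}_p$, i.e. the differents $\mathfrak{D}_{L/\mathbf{Q}_p}$ of the finite subextensions $L/\mathbf{Q}_p$ of $K_\infty$ are unbounded: for every $N\ge 0$ there is such an $L$ with $\mathfrak{D}_{L/\mathbf{Q}_p}\subseteq p^N\mathcal{O}_L$. Let $M/K_\infty$ be a finite Galois extension with group $G$, let $\chi: G\to K_\infty^\times$ be a homomorphism, let $M(\chi)$ be $M$ with the $G$-action $s\cdot m=\chi(s)\,s(m)$, and let $\mathcal{O}_M(\chi)\subset M(\chi)$ be the submodule given by the ring of integers $\mathcal{O}_M$ of $M$. Let $|\cdot|$ be the absolute value of $M$ extending that of $\mathbf{Q}_p$; for an $n$-cochain $f:G^n\to M(\chi)$, $n\ge 0$, put $|f|=\max_{\underline{s}\in G^n}|f(\underline{s})|$, and let $\delta$ be the usual coboundary of inhomogeneous cochains. By a $(-1)$-cochain we mean an element $y\in M(\chi)$; $|y|$ is its absolute value, and its coboundary $\delta y$ is the $0$-cochain $\sum_{s\in G}s\cdot y=\sum_{s\in G}\chi(s)\,s(y)$, the trace of $y$ in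 the $G$-module $M(\chi)$ (equal to $\mathrm{Tr}_{M/K_\infty}(y)$ if $\chi=1$). Then for every real $c>1$, every $n\ge 0$ and every $n$-cochain $f$ of $G$ with coefficients in $M(\chi)$ there exists an $(n-1)$-cochain $g$ of $G$ in $M(\chi)$ such that $$|f-\delta g|\le c\,|\delta f|\quad\text{and}\quad |g|\le c\,|f|.$$ In particular $H^q(G,\mathcal{O}_M(\chi))$ is killed by $p$ for all $q>0$. -/

import Mathlib

universe u

noncomputable section

namespace DeeplyRamified

/-- The ring of integers of a finite extension `L` of `ℚ_p` is a Dedekind domain; Mathlib's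
definition of the different ideal asks for this. -/
instance isDedekindDomain_integers (p : ℕ) [Fact p.Prime] (L : Type u) [Field L]
    [Algebra ℚ_[p] L] [Algebra ℤ_[p] L] [IsScalarTower ℤ_[p] ℚ_[p] L]
    [FiniteDimensional ℚ_[p] L] : IsDedekindDomain (integralClosure ℤ_[p] L) :=
  integralClosure.isDedekindDomain ℤ_[p] ℚ_[p] L

instance isTorsionFree_integers (p : ℕ) [Fact p.Prime] (L : Type u) [Field L]
    [Algebra ℚ_[p] L] [Algebra ℤ_[p] L] [IsScalarTower ℤ_[p] ℚ_[p] L] :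
    Module.IsTorsionFree ℤ_[p] (integralClosure ℤ_[p] L) := by
  have h : Function.Injective (algebraMap ℤ_[p] L) := by
    rw [IsScalarTower.algebraMap_eq ℤ_[p] ℚ_[p] L]
    exact (algebraMap ℚ_[p] L).injective.comp (IsFractionRing.injective ℤ_[p] ℚ_[p])
  have h' : Function.Injective (algebraMap ℤ_[p] (integralClosure ℤ_[p] L)) :=
    fun x y hxy => h (congrArg Subtype.val hxy)
  exact Module.isTorsionFree_iff_algebraMap_injective.mpr h'

/-- An algebraic extension `K` of `ℚ_p` is deeply ramified if the differents of its finite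
subextensions `L / ℚ_p` are unbounded, i.e. if for every `N` there is such an `L` whose different
over `ℚ_p` has `p`-adic valuation at least `N`. -/
def IsDeeplyRamified (p : ℕ) [Fact p.Prime] (K : Type u) [Field K]
    [Algebra ℚ_[p] K] [Algebra ℤ_[p] K] [IsScalarTower ℤ_[p] ℚ_[p] K] : Prop :=
  Algebra.IsAlgebraic ℚ_[p] K ∧
    ∀ N : ℕ, ∃ (L : IntermediateField ℚ_[p] K) (_ : FiniteDimensional ℚ_[p] L),
      differentIdeal ℤ_[p] (integralClosure ℤ_[p] L) ≤
        Ideal.span {(p : integralClosure ℤ_[p] L) ^ N}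

section Twist

variable {K M : Type u} [Field K] [Field M] [Algebra K M]

/-- `M(χ)`: the field `M` on which `s ∈ Gal(M/K)` acts by `m ↦ χ(s) · s(m)`. -/
def twist (χ : Gal(M/K) →* Kˣ) : Representation K Gal(M/K) M where
  toFun s := (χ s : K) • s.toLinearMap
  map_one' := by
    ext x
    simp
  map_mul' s t := by
    ext x
    simp [mul_smul, smul_comm (χ s : K) (χ t : K)]

/-- The action on `M(χ)` preserves integral elements. -/
theorem twist_mem_integers {A : Type u} [CommRing A] [Algebra A K] [Algebra A M]
    [IsScalarTower A K M] [FiniteDimensional K M] (χ : Gal(M/K) →* Kˣ) (s : Gal(M/K))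
    {x : M} (hx : x ∈ integralClosure A M) : twist χ s x ∈ integralClosure A M := by
  have h1 : IsIntegral A ((χ s : K)) := by
    refine IsIntegral.of_pow (n := Nat.card Gal(M/K)) Nat.card_pos ?_
    have : (χ s : K) ^ Nat.card Gal(M/K) = 1 := by
      rw [← Units.val_pow_eq_pow_val, ← map_pow, pow_card_eq_one', map_one, Units.val_one]
    rw [this]
    exact isIntegral_one
  have h2 : IsIntegral A (s x) := IsIntegral.map (s.toAlgHom.restrictScalars A) hx
  have h3 : twist χ s x = algebraMap K M (χ s) * s x := by
    simp [twist, Algebra.smul_def]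
  rw [h3]
  exact IsIntegral.mul h1.algebraMap h2

/-- `𝒪_M(χ)`: the integral closure `𝒪_M` in `M` of the subring `A` of `K`, with the action
`m ↦ χ(s) · s(m)` of `s ∈ Gal(M/K)`. -/
def integralTwist (A : Type u) [CommRing A] [Algebra A K] [Algebra A M]
    [IsScalarTower A K M] [FiniteDimensional K M] (χ : Gal(M/K) →* Kˣ) :
    Representation A Gal(M/K) (integralClosure A M) where
  toFun s :=
    { toFun := fun x => ⟨twist χ s (x : M), twist_mem_integers χ s x.2⟩
      map_add' := fun x y => Subtype.ext (by simp)
      map_smul' := fun a x => Subtype.ext (by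
        change twist χ s (a • (x : M)) = a • twist χ s (x : M)
        rw [← algebraMap_smul K a (x : M), map_smul, algebraMap_smul]) }
  map_one' := by
    ext x
    simp
  map_mul' s t := by
    ext x
    simp

/-- The coboundary `δ` of inhomogeneous `n`-cochains of `Gal(M/K)` in `M(χ)`, `n ≥ 0`. -/
def coboundary (χ : Gal(M/K) →* Kˣ) (n : ℕ) (f : (Fin n → Gal(M/K)) → M) :
    (Fin (n + 1) → Gal(M/K)) → M :=
  (inhomogeneousCochains.d (Rep.of (twist χ)) n).hom f

/-- The coboundary of a `(-1)`-cochain, i.e. of an element `y` of `M(χ)`: the `0`-cochain given by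
the trace `∑ s, s • y` of `y` in the `Gal(M/K)`-module `M(χ)`. -/
def coboundaryNegOne [FiniteDimensional K M] (χ : Gal(M/K) →* Kˣ) (y : M) :
    (Fin 0 → Gal(M/K)) → M :=
  fun _ => ∑ s : Gal(M/K), twist χ s y

end Twist

/-- `|f|`: the maximum of the absolute values of the values of the cochain `f`, for the unique
absolute value on `M` that extends the one of `ℚ_p`. -/
def cochainNorm (p : ℕ) [Fact p.Prime] {G M : Type u} [Field M] [Algebra ℚ_[p] M] {n : ℕ}
    (f : (Fin n → G) → M) : ℝ :=
  ⨆ s : Fin n → G, spectralNorm ℚ_[p] M (f s)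

end DeeplyRamified

end

/-! Everything reduces to an element `y` of `M` with `|y| ≤ c` and trace 1 to `K`. Cup product with
such a `y` is a contracting homotopy up to sign (`contraction_coboundary`): `y ∪ δf = δ(y ∪ f) ± f`.
It enlarges norms by at most `c`, since Galois acts by isometries and the absolute value is
nonarchimedean. So `g = ± y ∪ f` satisfies both bounds. The twist is harmless: `y` carries the
untwisted action and multiplies `M(χ)` equivariantly.

To find `y`, let `b` be an integer of `M` and let `E` be obtained by adjoining `b` to a finite
subextension of `K` with very small different. The integers of `E` are `ℤ_p[θ]`, so `b = P(θ)`.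
Differentiating the divisibility of `minpoly b ∘ P` by `minpoly θ` shows that `P'(θ)` is small, and
Taylor expansion gives `g b - b = P'(θ)(g θ - θ) + O((g θ - θ)²)`. Hence, for `g ≠ 1`, the supremum
`S > 0` of `|g b - b|` over integral `b` satisfies `S ≤ S²`, so `S ≥ 1` (`exists_integral_moved`). A
product of such differences over all `g ≠ 1` then forces some integral element to have trace almost
a unit (`exists_trace_eq_one`).

For the last claim take `c = p`: an integral cocycle is exactly `δg` with `|g| ≤ p`, and `p g` is
integral. -/

noncomputable section

namespace DeeplyRamified

open Polynomial

/-! ### Nonarchimedean estimates: from moved integers to large traces -/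

section AbsoluteValue

variable {M : Type u} [Field M] {v : AbsoluteValue M ℝ}

theorem nonarch_sub_le (hv : IsNonarchimedean v) {x y : M} {r : ℝ} (hx : v x ≤ r) (hy : v y ≤ r) :
    v (x - y) ≤ r := by
  rw [sub_eq_add_neg]
  refine (hv x (-y)).trans (max_le hx ?_)
  rwa [v.map_neg]

theorem nonarch_add_le (hv : IsNonarchimedean v) {x y : M} {r : ℝ} (hx : v x ≤ r) (hy : v y ≤ r) :
    v (x + y) ≤ r :=
  (hv x y).trans (max_le hx hy)

theorem nonarch_sum_le (hv : IsNonarchimedean v) {ι : Type*} (s : Finset ι) (f : ι → M) {r : ℝ}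
    (hr : 0 ≤ r) (h : ∀ i ∈ s, v (f i) ≤ r) : v (∑ i ∈ s, f i) ≤ r := by
  classical
  induction s using Finset.induction_on with
  | empty => simpa using hr
  | insert a s ha ih =>
    rw [Finset.sum_insert ha]
    exact nonarch_add_le hv (h a (Finset.mem_insert_self a s))
      (ih fun i hi => h i (Finset.mem_insert_of_mem hi))

variable {K : Type u} [Field K] [Algebra K M]

/-- If every integral element `b` can be approximated to first order, with arbitrarily small slope,
as a function of some integral `θ`, then every nontrivial automorphism moves some integral element
by almost a unit. -/
theorem exists_integral_moved (hv : IsNonarchimedean v) (hG : ∀ (g : Gal(M/K)) x, v (g x) = v x)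
    (happrox : ∀ b, v b ≤ 1 → ∀ ε : ℝ, 0 < ε → ∃ θ d : M, v θ ≤ 1 ∧ v d ≤ ε ∧
      ∀ g : Gal(M/K), v (g b - b - d * (g θ - θ)) ≤ v (g θ - θ) ^ 2)
    {g : Gal(M/K)} (hg : g ≠ 1) {r : ℝ} (hr : r < 1) : ∃ b, v b ≤ 1 ∧ r < v (g b - b) := by
  set S : Set ℝ := {t | ∃ b, v b ≤ 1 ∧ v (g b - b) = t} with hS
  have hbdd : BddAbove S := by
    refine ⟨1, ?_⟩
    rintro _ ⟨b, hb, rfl⟩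
    exact nonarch_sub_le hv ((hG g b).trans_le hb) hb
  have hne : S.Nonempty := ⟨0, 0, by simp, by simp⟩
  have hle : ∀ b, v b ≤ 1 → v (g b - b) ≤ sSup S := fun b hb => le_csSup hbdd ⟨b, hb, rfl⟩
  have hpos : 0 < sSup S := by
    obtain ⟨x, hx⟩ : ∃ x, g x ≠ x := by
      by_contra! h
      exact hg (AlgEquiv.ext h)
    obtain ⟨y, hy, hgy⟩ : ∃ y, v y ≤ 1 ∧ g y ≠ y := by
      rcases le_total (v x) 1 with h | h
      · exact ⟨x, h, hx⟩
      · refine ⟨x⁻¹, ?_, fun h' => hx ?_⟩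
        · rw [map_inv₀]
          exact inv_le_one_of_one_le₀ h
        · rw [map_inv₀] at h'
          exact inv_injective h'
    exact (v.pos (sub_ne_zero.mpr hgy)).trans_le (hle y hy)
  have hsq : sSup S ≤ sSup S ^ 2 := by
    refine csSup_le hne ?_
    rintro _ ⟨b, hb, rfl⟩
    -- The slope bound is `sSup S` itself, which makes the linear term as small as the quadratic
    -- one.
    obtain ⟨θ, d, hθ, hd, h⟩ := happrox b hb _ hpos
    have h1 := hle θ hθ
    have h2 : v (g b - b - d * (g θ - θ)) ≤ sSup S ^ 2 :=
      (h g).trans (pow_le_pow_left₀ (v.nonneg _) h1 2)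
    have h3 : v (d * (g θ - θ)) ≤ sSup S ^ 2 := by
      rw [map_mul, sq]
      exact mul_le_mul hd h1 (v.nonneg _) hpos.le
    simpa using nonarch_add_le hv h2 h3
  have h1 : 1 ≤ sSup S := by nlinarith
  obtain ⟨_, ⟨b, hb, rfl⟩, hlt⟩ := exists_lt_of_lt_csSup hne (hr.trans_le h1)
  exact ⟨b, hb, hlt⟩

/-- If every nontrivial automorphism moves some integral element by almost a unit, then the
trace of some integral element is almost a unit. -/
theorem exists_trace_eq_one [FiniteDimensional K M] [IsGalois K M] (hv : IsNonarchimedean v)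
    (hG : ∀ (g : Gal(M/K)) x, v (g x) = v x)
    (hmove : ∀ g : Gal(M/K), g ≠ 1 → ∀ r : ℝ, r < 1 → ∃ b, v b ≤ 1 ∧ r < v (g b - b))
    {c : ℝ} (hc : 1 < c) : ∃ y : M, v y ≤ c ∧ ∑ g : Gal(M/K), g y = 1 := by
  classical
  obtain ⟨r, hr0, hr1, hrc⟩ : ∃ r : ℝ, 0 < r ∧ r < 1 ∧
      c⁻¹ < r ^ ((Finset.univ.erase (1 : Gal(M/K))).card) := by
    have h1 : Filter.Tendsto (fun r : ℝ => r ^ ((Finset.univ.erase (1 : Gal(M/K))).card))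
        (nhdsWithin 1 (Set.Iio 1)) (nhds 1) := by
      have : Continuous fun r : ℝ => r ^ ((Finset.univ.erase (1 : Gal(M/K))).card) := by fun_prop
      simpa using (this.tendsto 1).mono_left nhdsWithin_le_nhds
    have h2 := h1.eventually (lt_mem_nhds (inv_lt_one_of_one_lt₀ hc))
    have h3 : ∀ᶠ r : ℝ in nhdsWithin 1 (Set.Iio 1), r ∈ Set.Ioo (0 : ℝ) 1 :=
      Ioo_mem_nhdsLT zero_lt_one
    obtain ⟨r, hr, hr'⟩ := (h2.and h3).exists
    exact ⟨r, hr'.1, hr'.2, hr⟩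
  choose! b hb hbr using fun g hg => hmove g hg r hr1
  by_contra! hcon
  -- A trace `t` with `v t > c⁻¹` is Galois-fixed, so `t⁻¹ * x` would have trace 1 and norm at most
  -- `c`.
  have htr : ∀ x, v x ≤ 1 → v (∑ g : Gal(M/K), g x) ≤ c⁻¹ := by
    intro x hx
    by_contra! h
    have hc0 : 0 < c⁻¹ := inv_pos.mpr (zero_lt_one.trans hc)
    set t := ∑ g : Gal(M/K), g x with ht
    have hvt : 0 < v t := hc0.trans h
    have ht0 : t ≠ 0 := by
      intro h0
      simp [h0] at hvt
    have hfix : ∀ g : Gal(M/K), g t = t := by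
      intro g
      rw [ht, map_sum]
      exact Fintype.sum_equiv (Equiv.mulLeft g) _ _ fun s => rfl
    refine hcon (t⁻¹ * x) ?_ ?_
    · rw [map_mul, map_inv₀]
      calc (v t)⁻¹ * v x ≤ (v t)⁻¹ * 1 := by gcongr
        _ ≤ c := by
          rw [mul_one]
          exact (inv_le_comm₀ hvt (zero_lt_one.trans hc)).mpr h.le
    · simp_rw [map_mul, map_inv₀, hfix]
      rw [← Finset.mul_sum]
      exact inv_mul_cancel₀ ht0
  -- Multiplied out, the sum is a combination of traces of integral elements with integral
  -- coefficients: `a (b a)` does not depend on `h`, and `h (b a)` is absorbed into `h x`.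
  have key : ∀ (S : Finset Gal(M/K)), (∀ g ∈ S, g ≠ 1) → ∀ x, v x ≤ 1 →
      v (∑ h : Gal(M/K), (∏ g ∈ S, (g (b g) - h (b g))) * h x) ≤ c⁻¹ := by
    intro S
    induction S using Finset.induction_on with
    | empty => simpa using htr
    | insert a S ha ih =>
      intro hS x hx
      have ih' := ih fun g hg => hS g (Finset.mem_insert_of_mem hg)
      have hba : v (b a) ≤ 1 := hb a (hS a (Finset.mem_insert_self a S))
      have h1 := ih' x hx
      have h2 := ih' (b a * x) (by rw [map_mul]; exact mul_le_one₀ hba (v.nonneg _) hx)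
      have h3 : v (a (b a) * ∑ h : Gal(M/K), (∏ g ∈ S, (g (b g) - h (b g))) * h x) ≤ c⁻¹ := by
        rw [map_mul, hG]
        exact (mul_le_of_le_one_left (v.nonneg _) hba).trans h1
      refine le_of_eq_of_le (congrArg v ?_) (nonarch_sub_le hv h3 h2)
      rw [Finset.mul_sum, ← Finset.sum_sub_distrib]
      refine Finset.sum_congr rfl fun h _ => ?_
      rw [Finset.prod_insert ha, map_mul]
      ring
  have h1 := key (Finset.univ.erase 1) (fun g hg => Finset.ne_of_mem_erase hg) 1 (by simp)
  -- For `h ≠ 1` the factor with `g = h` vanishes; the term `h = 1` is `∏ (g (b g) - b g)`, which is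
  -- too large.
  rw [Finset.sum_eq_single 1 (fun h _ hh => by
    rw [Finset.prod_eq_zero (Finset.mem_erase.mpr ⟨hh, Finset.mem_univ h⟩) (sub_self _), zero_mul])
    (by simp), map_mul, map_prod, map_one, map_one, mul_one] at h1
  refine absurd (hrc.trans_le ?_) (not_lt.mpr h1)
  rw [← Finset.prod_const]
  refine Finset.prod_le_prod (fun _ _ => hr0.le) fun g hg => ?_
  exact (hbr g (Finset.ne_of_mem_erase hg)).le

end AbsoluteValue

/-! ### Monogenic discrete valuation rings -/

/-- A discrete valuation ring that is finite over a local ring and has a finite residue field is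
generated by one element. -/
theorem exists_adjoin_eq_top (A B : Type*) [CommRing A] [IsLocalRing A] [CommRing B] [IsDomain B]
    [IsDiscreteValuationRing B] [Algebra A B] [Module.Finite A B]
    [Finite (IsLocalRing.ResidueField B)]
    (hm : (IsLocalRing.maximalIdeal A).map (algebraMap A B) ≠ ⊥) :
    ∃ θ : B, Algebra.adjoin A {θ} = ⊤ := by
  classical
  obtain ⟨ϖ, hϖ⟩ := IsDiscreteValuationRing.exists_irreducible B
  have hmax : IsLocalRing.maximalIdeal B = Ideal.span {ϖ} := hϖ.maximalIdeal_eq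
  have hϖm : ϖ ∈ IsLocalRing.maximalIdeal B := hmax ▸ Ideal.mem_span_singleton_self ϖ
  have := Fintype.ofFinite (IsLocalRing.ResidueField B)
  set q := Fintype.card (IsLocalRing.ResidueField B) with hq
  have hqm : (q : B) ∈ IsLocalRing.maximalIdeal B := by
    rw [← IsLocalRing.residue_eq_zero_iff, map_natCast, hq]
    exact FiniteField.cast_card_eq_zero _
  have hq1 : 1 < q := Fintype.one_lt_card
  obtain ⟨a, ha⟩ := IsCyclic.exists_generator (α := (IsLocalRing.ResidueField B)ˣ)
  obtain ⟨x, hx⟩ := IsLocalRing.residue_surjective (a : IsLocalRing.ResidueField B)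
  have hpow : ∀ y : B, y ^ q - y ∈ IsLocalRing.maximalIdeal B := by
    intro y
    rw [← IsLocalRing.residue_eq_zero_iff, map_sub, map_pow, hq, FiniteField.pow_card, sub_self]
  -- If `x ^ q - x` is divisible by `ϖ ^ 2`, pass to `x + ϖ`: modulo `ϖ ^ 2` this adds `(q x ^ (q -
  -- 1) - 1) ϖ`, whose coefficient is a unit because `q` lies in the maximal ideal.
  obtain ⟨θ, hθ, hirr⟩ : ∃ θ : B, IsLocalRing.residue B θ = a ∧ Irreducible (θ ^ q - θ) := by
    have hcrit : ∀ y : B, ¬ ϖ ^ 2 ∣ y ^ q - y → Irreducible (y ^ q - y) := by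
      intro y hy
      obtain ⟨z, hz⟩ := Ideal.mem_span_singleton'.mp (hmax ▸ hpow y)
      have hzu : IsUnit z := by
        by_contra hzu
        have : z ∈ IsLocalRing.maximalIdeal B := hzu
        obtain ⟨w, hw⟩ := Ideal.mem_span_singleton'.mp (hmax ▸ this)
        exact hy ⟨w, by rw [← hz, ← hw]; ring⟩
      rw [← hz]
      exact (irreducible_isUnit_mul hzu).mpr hϖ
    by_cases h : ϖ ^ 2 ∣ x ^ q - x
    · refine ⟨x + ϖ, ?_, hcrit _ fun h' => ?_⟩
      · rw [map_add, hx, (IsLocalRing.residue_eq_zero_iff _).mpr hϖm, add_zero]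
      · obtain ⟨k, hk⟩ := (X ^ q - X : B[X]).binomExpansion x ϖ
        simp only [eval_sub, eval_pow, eval_X, derivative_sub, derivative_X_pow, derivative_X,
          eval_mul, eval_C, eval_one] at hk
        rw [hk] at h'
        have h1 : ϖ ^ 2 ∣ ((q : B) * x ^ (q - 1) - 1) * ϖ := by
          have := dvd_sub (dvd_sub h' h) (Dvd.intro_left k rfl)
          convert this using 1
          ring
        rw [sq] at h1
        have h2 : ϖ ∣ (q : B) * x ^ (q - 1) - 1 := (mul_dvd_mul_iff_right hϖ.ne_zero).mp h1
        have h3 : (q : B) * x ^ (q - 1) - 1 ∈ IsLocalRing.maximalIdeal B :=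
          hmax ▸ Ideal.mem_span_singleton.mpr h2
        have h4 := sub_mem (Ideal.mul_mem_right (x ^ (q - 1)) _ hqm) h3
        rw [sub_sub_cancel] at h4
        exact (Ideal.ne_top_iff_one _).mp (IsLocalRing.maximalIdeal.isMaximal B).ne_top h4
    · exact ⟨x, hx, hcrit x h⟩
  refine ⟨θ, ?_⟩
  set R := Algebra.adjoin A {θ} with hR
  have hθR : θ ∈ R := Algebra.self_mem_adjoin_singleton A θ
  set π := θ ^ q - θ with hπ
  have hπR : π ∈ R := sub_mem (pow_mem hθR q) hθR
  have hmaxπ : IsLocalRing.maximalIdeal B = Ideal.span {π} := hirr.maximalIdeal_eq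
  have hone : ∀ b : B, ∃ r ∈ R, ∃ c, b = r + π * c := by
    intro b
    obtain ⟨r, hr, hrb⟩ : ∃ r ∈ R, IsLocalRing.residue B r = IsLocalRing.residue B b := by
      by_cases hb : IsLocalRing.residue B b = 0
      · exact ⟨0, zero_mem _, by rw [hb, map_zero]⟩
      · obtain ⟨n, hn⟩ := (mem_powers_iff_mem_zpowers.mpr (ha (Units.mk0 _ hb)))
        refine ⟨θ ^ n, pow_mem hθR n, ?_⟩
        rw [map_pow, hθ]
        simpa using congrArg Units.val hn
    have : b - r ∈ IsLocalRing.maximalIdeal B := by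
      rw [← IsLocalRing.residue_eq_zero_iff, map_sub, hrb, sub_self]
    obtain ⟨c, hc⟩ := Ideal.mem_span_singleton'.mp (hmaxπ ▸ this)
    exact ⟨r, hr, c, by rw [mul_comm, hc]; ring⟩
  have hpows : ∀ (k : ℕ) (b : B), ∃ r ∈ R, ∃ c, b = r + π ^ k * c := by
    intro k
    induction k with
    | zero => exact fun b => ⟨0, zero_mem _, b, by simp⟩
    | succ k ih =>
      intro b
      obtain ⟨r, hr, c, rfl⟩ := ih b
      obtain ⟨s, hs, d, rfl⟩ := hone c
      exact ⟨r + π ^ k * s, add_mem hr (mul_mem (pow_mem hπR k) hs), d, by ring⟩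
  -- The maximal ideal of `A` generates `(π ^ k)`, so approximation modulo `π ^ k` is exactly the
  -- hypothesis of Nakayama's lemma.
  obtain ⟨k, hk⟩ := IsDiscreteValuationRing.ideal_eq_span_pow_irreducible hm hirr
  have hnak : (⊤ : Submodule A B) ≤ Subalgebra.toSubmodule R := by
    refine Submodule.le_of_le_smul_of_le_jacobson_bot (I := IsLocalRing.maximalIdeal A)
      Module.Finite.fg_top ?_ ?_
    · rw [IsLocalRing.jacobson_eq_maximalIdeal _ bot_ne_top]
    · intro b _
      obtain ⟨r, hr, c, rfl⟩ := hpows k b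
      refine Submodule.add_mem_sup hr ?_
      rw [Ideal.smul_top_eq_map, Submodule.restrictScalars_mem, hk]
      exact Ideal.mul_mem_right _ _ (Ideal.mem_span_singleton_self _)
  exact top_le_iff.mp fun b _ => hnak trivial

/-! ### The absolute value and the integers of extensions of `ℚ_p` -/

section Padic

variable (p : ℕ) [Fact p.Prime]

/-- The absolute value on an algebraic extension of `ℚ_p` that extends the one of `ℚ_p`. -/
def padicAbs (L : Type*) [Field L] [Algebra ℚ_[p] L] [Algebra.IsAlgebraic ℚ_[p] L] :
    AbsoluteValue L ℝ where
  toFun := spectralNorm ℚ_[p] L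
  map_mul' := spectralAlgNorm_mul
  nonneg' := spectralNorm_nonneg
  eq_zero' x := ⟨fun h => eq_zero_of_map_spectralNorm_eq_zero h (Algebra.IsAlgebraic.isAlgebraic x),
    fun h => h ▸ spectralNorm_zero⟩
  add_le' _ _ := IsNonarchimedean.add_le spectralNorm_nonneg isNonarchimedean_spectralNorm

section

variable (L : Type*) [Field L] [Algebra ℚ_[p] L] [Algebra.IsAlgebraic ℚ_[p] L]

theorem padicAbs_apply (x : L) : padicAbs p L x = spectralNorm ℚ_[p] L x := rfl

theorem isNonarchimedean_padicAbs : IsNonarchimedean (padicAbs p L) :=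
  isNonarchimedean_spectralNorm (K := ℚ_[p]) (L := L)

theorem padicAbs_algebraMap (x : ℚ_[p]) : padicAbs p L (algebraMap ℚ_[p] L x) = ‖x‖ :=
  spectralNorm_extends x

theorem padicAbs_natCast : padicAbs p L (p : L) = (p : ℝ)⁻¹ := by
  rw [← map_natCast (algebraMap ℚ_[p] L), padicAbs_algebraMap, Padic.norm_p]

/-- The spectral norm is at most 1 exactly when the minimal polynomial over `ℚ_p` has coefficients
in `ℤ_p`; as `ℤ_p` is integrally closed, this is integrality. -/
theorem isIntegral_iff_padicAbs_le_one [Algebra ℤ_[p] L] [IsScalarTower ℤ_[p] ℚ_[p] L] {x : L} :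
    IsIntegral ℤ_[p] x ↔ padicAbs p L x ≤ 1 := by
  have hx : IsIntegral ℚ_[p] x := Algebra.IsIntegral.isIntegral x
  have hmonic : (minpoly ℚ_[p] x).Monic := minpoly.monic hx
  rw [padicAbs_apply, spectralNorm, spectralValue_le_one_iff hmonic]
  constructor
  · intro h n
    rw [minpoly.isIntegrallyClosed_eq_field_fractions' ℚ_[p] h, coeff_map]
    exact PadicInt.norm_le_one _
  · intro h
    have hl : minpoly ℚ_[p] x ∈ lifts (algebraMap ℤ_[p] ℚ_[p]) := by
      rw [lifts_iff_coeff_lifts]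
      exact fun n => ⟨⟨_, h n⟩, rfl⟩
    obtain ⟨P, hP, -, hPm⟩ := lifts_and_degree_eq_and_monic hl hmonic
    refine ⟨P, hPm, ?_⟩
    rw [← aeval_def, ← aeval_map_algebraMap ℚ_[p], hP, minpoly.aeval]

end

section Finite

variable (L : Type u) [Field L] [Algebra ℚ_[p] L] [Algebra ℤ_[p] L] [IsScalarTower ℤ_[p] ℚ_[p] L]
  [FiniteDimensional ℚ_[p] L]

theorem isUnit_integers_iff (x : integralClosure ℤ_[p] L) :
    IsUnit x ↔ padicAbs p L (x : L) = 1 := by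
  have hle : ∀ y : integralClosure ℤ_[p] L, padicAbs p L (y : L) ≤ 1 := fun y =>
    (isIntegral_iff_padicAbs_le_one p L).mp y.2
  constructor
  · rintro ⟨u, rfl⟩
    refine le_antisymm (hle _) ?_
    have h : padicAbs p L ((u : integralClosure ℤ_[p] L) : L) *
        padicAbs p L (((u⁻¹ : (integralClosure ℤ_[p] L)ˣ) : integralClosure ℤ_[p] L) : L) = 1 := by
      rw [← map_mul, ← Subalgebra.coe_mul, Units.mul_inv, Subalgebra.coe_one, map_one]
    rw [← h]
    exact mul_le_of_le_one_right ((padicAbs p L).nonneg _) (hle _)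
  · intro h
    have h0 : (x : L) ≠ 0 := by
      rw [← (padicAbs p L).ne_zero_iff, h]
      exact one_ne_zero
    have hinv : (x : L)⁻¹ ∈ integralClosure ℤ_[p] L := by
      refine (isIntegral_iff_padicAbs_le_one p L).mpr ?_
      rw [map_inv₀, h, inv_one]
    exact IsUnit.of_mul_eq_one ⟨(x : L)⁻¹, hinv⟩ (Subtype.ext (mul_inv_cancel₀ h0))

instance isLocalRing_integers : IsLocalRing (integralClosure ℤ_[p] L) := by
  refine IsLocalRing.of_nonunits_add fun a b ha hb => ?_
  have hlt : ∀ y ∈ nonunits (integralClosure ℤ_[p] L), padicAbs p L (y : L) < 1 := fun y hy =>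
    lt_of_le_of_ne ((isIntegral_iff_padicAbs_le_one p L).mp y.2)
      (mt (isUnit_integers_iff p L y).mpr hy)
  refine mt (isUnit_integers_iff p L _).mp (ne_of_lt ?_)
  rw [Subalgebra.coe_add]
  exact (isNonarchimedean_padicAbs p L _ _).trans_lt (max_lt (hlt a ha) (hlt b hb))

omit [IsScalarTower ℤ_[p] ℚ_[p] L] [FiniteDimensional ℚ_[p] L] in
theorem natCast_prime_ne_zero : (p : integralClosure ℤ_[p] L) ≠ 0 := by
  intro h
  have h1 : (p : L) = 0 := by
    simpa using congrArg (Subtype.val) h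
  have h2 : (p : ℚ_[p]) = 0 := by
    apply (algebraMap ℚ_[p] L).injective
    rw [map_natCast, h1, map_zero]
  exact (Nat.cast_ne_zero.mpr (Fact.out : p.Prime).ne_zero) h2

instance isDiscreteValuationRing_integers :
    IsDiscreteValuationRing (integralClosure ℤ_[p] L) := by
  have hnf : ¬ IsField (integralClosure ℤ_[p] L) := by
    rw [← Algebra.IsIntegral.isField_iff_isField (R := ℤ_[p])
      (FaithfulSMul.algebraMap_injective ℤ_[p] (integralClosure ℤ_[p] L))]
    exact IsDiscreteValuationRing.not_isField ℤ_[p]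
  exact ((IsDiscreteValuationRing.TFAE (integralClosure ℤ_[p] L) hnf).out 0 2).mpr
    (isDedekindDomain_integers p L)

theorem finite_integers : Module.Finite ℤ_[p] (integralClosure ℤ_[p] L) :=
  IsIntegralClosure.finite ℤ_[p] ℚ_[p] L (integralClosure ℤ_[p] L)

/-- The ring of integers of a finite extension of `ℚ_p` is generated by one element. -/
theorem exists_integers_adjoin_eq_top :
    ∃ θ : integralClosure ℤ_[p] L, Algebra.adjoin ℤ_[p] {θ} = ⊤ := by
  have := finite_integers p L
  have : Finite (IsLocalRing.ResidueField (integralClosure ℤ_[p] L)) :=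
    Module.finite_of_finite (IsLocalRing.ResidueField ℤ_[p])
  refine exists_adjoin_eq_top _ _ fun h => natCast_prime_ne_zero p L ?_
  have h1 : algebraMap ℤ_[p] (integralClosure ℤ_[p] L) (p : ℤ_[p]) ∈
      (IsLocalRing.maximalIdeal ℤ_[p]).map (algebraMap ℤ_[p] (integralClosure ℤ_[p] L)) := by
    refine Ideal.mem_map_of_mem _ ?_
    rw [PadicInt.maximalIdeal_eq_span_p]
    exact Ideal.mem_span_singleton_self _
  rw [h, Ideal.mem_bot, map_natCast] at h1
  exact h1

end Finite

end Padic

/-! ### Small differents and small derivatives -/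

section Different

variable (p : ℕ) [Fact p.Prime] (L : Type u) [Field L] [Algebra ℚ_[p] L] [Algebra ℤ_[p] L]
  [IsScalarTower ℤ_[p] ℚ_[p] L] [FiniteDimensional ℚ_[p] L]

/-- The different of a finite extension `L` of `ℚ_p` is contained in `(p ^ N)` if and only if the
traces of the integers of `L` are divisible by `p ^ N`. -/
theorem differentIdeal_le_span_pow_iff (N : ℕ) :
    differentIdeal ℤ_[p] (integralClosure ℤ_[p] L) ≤
        Ideal.span {(p : integralClosure ℤ_[p] L) ^ N} ↔
      ∀ x : L, IsIntegral ℤ_[p] x → ∃ z : ℤ_[p],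
        Algebra.trace ℚ_[p] L x = (p : ℚ_[p]) ^ N * algebraMap ℤ_[p] ℚ_[p] z := by
  have hfrac := integralClosure.isFractionRing_of_finite_extension ℚ_[p] L (A := ℤ_[p])
  have hI : Ideal.span {(p : integralClosure ℤ_[p] L) ^ N} ≠ ⊥ := by
    rw [Ne, Ideal.span_singleton_eq_bot]
    exact pow_ne_zero _ (natCast_prime_ne_zero p L)
  have hp : (p : ℚ_[p]) ^ N ≠ 0 := pow_ne_zero _ (Nat.cast_ne_zero.mpr (Fact.out : p.Prime).ne_zero)
  have hmul : ∀ x : L, x * ((p : L) ^ N)⁻¹ = ((p : ℚ_[p]) ^ N)⁻¹ • x := by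
    intro x
    rw [Algebra.smul_def, map_inv₀, map_pow, map_natCast, mul_comm]
  -- Duality for the trace form: the different lies in `I` iff `I⁻¹` has integral traces.
  rw [differentialIdeal_le_iff (K := ℚ_[p]) (L := L) hI, FractionalIdeal.coeIdeal_span_singleton,
    FractionalIdeal.spanSingleton_inv, FractionalIdeal.coe_spanSingleton, map_pow, map_natCast]
  constructor
  · intro h x hx
    have h1 : (x * ((p : L) ^ N)⁻¹) ∈ (Submodule.span (integralClosure ℤ_[p] L)
        {((p : L) ^ N)⁻¹}).restrictScalars ℤ_[p] :=
      Submodule.mem_span_singleton.mpr ⟨⟨x, hx⟩, rfl⟩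
    obtain ⟨z, hz⟩ := Submodule.mem_one.mp (h (Submodule.mem_map_of_mem h1))
    refine ⟨z, ?_⟩
    rw [hz, LinearMap.restrictScalars_apply, hmul, map_smul, smul_eq_mul, mul_inv_cancel_left₀ hp]
  · rintro h _ ⟨y, hy, rfl⟩
    obtain ⟨a, rfl⟩ := Submodule.mem_span_singleton.mp hy
    obtain ⟨z, hz⟩ := h a a.2
    refine Submodule.mem_one.mpr ⟨z, ?_⟩
    rw [LinearMap.restrictScalars_apply, Algebra.smul_def]
    change _ = Algebra.trace ℚ_[p] L ((a : L) * ((p : L) ^ N)⁻¹)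
    rw [hmul, map_smul, smul_eq_mul, hz, inv_mul_cancel_left₀ hp]

/-- Divisibility of the different by `p ^ N` is inherited by finite extensions. -/
theorem differentIdeal_le_span_pow_of_tower {N : ℕ}
    (h : differentIdeal ℤ_[p] (integralClosure ℤ_[p] L) ≤
        Ideal.span {(p : integralClosure ℤ_[p] L) ^ N})
    (E : Type u) [Field E] [Algebra ℚ_[p] E] [Algebra ℤ_[p] E] [IsScalarTower ℤ_[p] ℚ_[p] E]
    [FiniteDimensional ℚ_[p] E] [Algebra L E] [IsScalarTower ℚ_[p] L E] :
    differentIdeal ℤ_[p] (integralClosure ℤ_[p] E) ≤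
        Ideal.span {(p : integralClosure ℤ_[p] E) ^ N} := by
  have : IsScalarTower ℤ_[p] L E := by
    refine IsScalarTower.of_algebraMap_eq fun x => ?_
    rw [IsScalarTower.algebraMap_apply ℤ_[p] ℚ_[p] E, IsScalarTower.algebraMap_apply ℤ_[p] ℚ_[p] L,
      ← IsScalarTower.algebraMap_apply ℚ_[p] L E]
  have : FiniteDimensional L E := FiniteDimensional.right ℚ_[p] L E
  -- In terms of traces, the claim is transitivity of the trace.
  rw [differentIdeal_le_span_pow_iff] at h ⊢
  intro x hx
  rw [← Algebra.trace_trace (S := L)]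
  exact h _ (Algebra.isIntegral_trace hx)

/-- If the different of `L` is divisible by `p ^ N`, then every integer `b` of `L` is a polynomial
in some integer `θ` with derivative almost divisible by `p ^ N`, with a defect bounded in
terms of `b`. -/
theorem exists_aeval_eq_of_differentIdeal_le {N : ℕ}
    (h : differentIdeal ℤ_[p] (integralClosure ℤ_[p] L) ≤
        Ideal.span {(p : integralClosure ℤ_[p] L) ^ N}) {b : L} (hb : IsIntegral ℤ_[p] b) :
    ∃ (θ : L) (P : ℤ_[p][X]), IsIntegral ℤ_[p] θ ∧ aeval θ P = b ∧
      padicAbs p L (aeval b (derivative (minpoly ℤ_[p] b))) * padicAbs p L (aeval θ (derivative P))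
        ≤ ((p : ℝ)⁻¹) ^ N := by
  have hfrac := integralClosure.isFractionRing_of_finite_extension ℚ_[p] L (A := ℤ_[p])
  obtain ⟨θ, hθ⟩ := exists_integers_adjoin_eq_top p L
  have hP : ∀ x : integralClosure ℤ_[p] L, ∃ P : ℤ_[p][X], aeval θ P = x := by
    intro x
    have hx : x ∈ Algebra.adjoin ℤ_[p] {θ} := hθ ▸ Algebra.mem_top
    rwa [Algebra.adjoin_singleton_eq_range_aeval] at hx
  obtain ⟨P, hPb⟩ := hP ⟨b, hb⟩
  have hcoe : ∀ Q : ℤ_[p][X], aeval (θ : L) Q = (aeval θ Q : integralClosure ℤ_[p] L) := fun Q =>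
    aeval_algebraMap_apply L θ Q
  have hPb' : aeval (θ : L) P = b := by rw [hcoe, hPb]
  refine ⟨θ, P, θ.2, hPb', ?_⟩
  obtain ⟨Q, hQ⟩ : minpoly ℤ_[p] θ ∣ (minpoly ℤ_[p] b).comp P := by
    refine minpoly.isIntegrallyClosed_dvd (Algebra.IsIntegral.isIntegral θ) ?_
    refine Subtype.ext ?_
    rw [← hcoe, aeval_comp, hPb', minpoly.aeval]
    rfl
  -- The chain rule on the left, the product rule on the right; the term containing `minpoly θ`
  -- vanishes at `θ`.
  have hder : aeval b (derivative (minpoly ℤ_[p] b)) * aeval (θ : L) (derivative P) =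
      aeval (θ : L) (derivative (minpoly ℤ_[p] θ)) * aeval (θ : L) Q := by
    have h1 := congrArg (fun R => aeval (θ : L) (derivative R)) hQ
    simp only [derivative_comp, derivative_mul, map_mul, map_add, aeval_comp, hPb'] at h1
    have h0 : aeval (θ : L) (minpoly ℤ_[p] θ) = 0 := by
      rw [hcoe, minpoly.aeval]
      rfl
    rw [h0, zero_mul, add_zero] at h1
    rw [← h1, mul_comm]
  have hgen : Algebra.adjoin ℚ_[p] {algebraMap (integralClosure ℤ_[p] L) L θ} = ⊤ := by
    refine top_le_iff.mp fun x _ => ?_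
    obtain ⟨y, hy, hyx⟩ := exists_integral_multiples ℤ_[p] ℚ_[p] {x}
    obtain ⟨R, hR⟩ := hP ⟨y • x, hyx x (Finset.mem_singleton_self x)⟩
    have hR' : aeval (θ : L) R = y • x := by rw [hcoe, hR]
    have hy' : algebraMap ℤ_[p] ℚ_[p] y ≠ 0 :=
      (map_ne_zero_iff _ (IsFractionRing.injective ℤ_[p] ℚ_[p])).mpr hy
    have hx : x = (algebraMap ℤ_[p] ℚ_[p] y)⁻¹ • aeval (θ : L) (R.map (algebraMap ℤ_[p] ℚ_[p])) := by
      rw [aeval_map_algebraMap, hR', ← algebraMap_smul ℚ_[p] y x, inv_smul_smul₀ hy']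
    rw [hx]
    exact Subalgebra.smul_mem _ (aeval_mem_adjoin_singleton ℚ_[p] (θ : L)) _
  -- The derivative of `minpoly θ` at `θ` lies in the different, hence in `(p ^ N)`.
  obtain ⟨w, hw⟩ := Ideal.mem_span_singleton'.mp
    (h (aeval_derivative_mem_differentIdeal ℤ_[p] ℚ_[p] L θ hgen))
  rw [← map_mul, hder, hcoe, ← hw, Subalgebra.coe_mul, Subalgebra.coe_pow, map_mul, map_mul,
    map_pow]
  have hle : ∀ y : integralClosure ℤ_[p] L, padicAbs p L (y : L) ≤ 1 := fun y =>
    (isIntegral_iff_padicAbs_le_one p L).mp y.2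
  have hpp : padicAbs p L ((p : integralClosure ℤ_[p] L) : L) = (p : ℝ)⁻¹ := by
    rw [← padicAbs_natCast p L]
    rfl
  rw [hpp, hcoe]
  have h0 : 0 ≤ ((p : ℝ)⁻¹) ^ N := by positivity
  calc _ ≤ 1 * ((p : ℝ)⁻¹) ^ N * 1 := by
        gcongr
        · exact hle _
        · exact hle _
    _ = _ := by ring

end Different

/-! ### Almost surjectivity of the trace over deeply ramified fields -/

section AlmostTrace

variable {p : ℕ} [Fact p.Prime] {K M : Type u} [Field K] [Field M]
  [Algebra ℚ_[p] K] [Algebra K M] [Algebra ℚ_[p] M] [IsScalarTower ℚ_[p] K M]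

theorem padicAbs_galois [Algebra.IsAlgebraic ℚ_[p] M] (g : Gal(M/K)) (x : M) :
    padicAbs p M (g x) = padicAbs p M x :=
  (spectralNorm_eq_of_equiv (g.restrictScalars ℚ_[p]) x).symm

variable [Algebra ℤ_[p] K] [IsScalarTower ℤ_[p] ℚ_[p] K]

/-- Over a deeply ramified field, every integer `b` of `M` depends to first order only with a very
small slope on some integer `θ`. -/
theorem IsDeeplyRamified.exists_small_slope (hK : IsDeeplyRamified p K)
    [Algebra.IsAlgebraic ℚ_[p] M] (b : M) (hb : padicAbs p M b ≤ 1) {ε : ℝ} (hε : 0 < ε) :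
    ∃ θ d : M, padicAbs p M θ ≤ 1 ∧ padicAbs p M d ≤ ε ∧
      ∀ g : Gal(M/K), padicAbs p M (g b - b - d * (g θ - θ)) ≤ padicAbs p M (g θ - θ) ^ 2 := by
  let _ : Algebra ℤ_[p] M := Algebra.compHom M (algebraMap ℤ_[p] ℚ_[p])
  have : IsScalarTower ℤ_[p] ℚ_[p] M := IsScalarTower.of_algebraMap_eq fun _ => rfl
  have hint := fun x => isIntegral_iff_padicAbs_le_one p M (x := x)
  have hbint : IsIntegral ℤ_[p] b := (hint b).mpr hb
  set η := padicAbs p M (aeval b (derivative (minpoly ℤ_[p] b))) with hη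
  have hη0 : 0 < η := by
    refine (padicAbs p M).pos ?_
    have h1 : (minpoly ℚ_[p] b).Separable :=
      (minpoly.irreducible (Algebra.IsIntegral.isIntegral b)).separable
    have h2 := h1.aeval_derivative_ne_zero (minpoly.aeval ℚ_[p] b)
    rwa [minpoly.isIntegrallyClosed_eq_field_fractions' ℚ_[p] hbint, derivative_map,
      aeval_map_algebraMap] at h2
  have hp1 : (p : ℝ)⁻¹ < 1 := inv_lt_one_of_one_lt₀ (by exact_mod_cast (Fact.out : p.Prime).one_lt)
  -- The defect `η` depends only on `b`, so `N` can be fixed before `L` is chosen.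
  obtain ⟨N, hN⟩ := exists_pow_lt_of_lt_one (mul_pos hη0 hε) hp1
  obtain ⟨L, hL, hLN⟩ := hK.2 N
  have hbL : IsIntegral L b := (Algebra.IsIntegral.isIntegral (R := ℚ_[p]) b).tower_top
  let E := IntermediateField.adjoin L {b}
  have hLE : FiniteDimensional L E := IntermediateField.adjoin.finiteDimensional hbL
  have hE : FiniteDimensional ℚ_[p] E := FiniteDimensional.trans ℚ_[p] L E
  let _ : Algebra ℤ_[p] E := Algebra.compHom E (algebraMap ℤ_[p] ℚ_[p])
  have : IsScalarTower ℤ_[p] ℚ_[p] E := IsScalarTower.of_algebraMap_eq fun _ => rfl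
  have : IsScalarTower ℤ_[p] E M := IsScalarTower.of_algebraMap_eq fun _ => rfl
  have hEN := differentIdeal_le_span_pow_of_tower p L hLN E
  have : IsScalarTower ℚ_[p] E M := IsScalarTower.of_algebraMap_eq fun _ => rfl
  have hEM : ∀ x : E, padicAbs p E x = padicAbs p M (algebraMap E M x) := fun x =>
    spectralNorm.eq_of_tower x
  let β : E := IntermediateField.AdjoinSimple.gen L b
  have hβ : algebraMap E M β = b := IntermediateField.AdjoinSimple.algebraMap_gen L b
  have hβint : IsIntegral ℤ_[p] β := by
    rwa [isIntegral_iff_padicAbs_le_one p E, hEM, hβ]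
  obtain ⟨θ, P, hθ, hPβ, hP⟩ := exists_aeval_eq_of_differentIdeal_le p E hEN hβint
  have hmin : minpoly ℤ_[p] β = minpoly ℤ_[p] b := by
    rw [← hβ, minpoly.algebraMap_eq (algebraMap E M).injective]
  rw [hmin, hEM, hEM, ← aeval_algebraMap_apply, ← aeval_algebraMap_apply, hβ] at hP
  have hPb : aeval (algebraMap E M θ) P = b := by rw [aeval_algebraMap_apply, hPβ, hβ]
  have hθM : IsIntegral ℤ_[p] (algebraMap E M θ) := hθ.algebraMap
  refine ⟨algebraMap E M θ, aeval (algebraMap E M θ) (derivative P), (hint _).mp hθM, ?_, ?_⟩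
  · refine le_of_mul_le_mul_left (hP.trans ?_) hη0
    exact hN.le
  · intro g
    set t := algebraMap E M θ with ht
    have hgt : IsIntegral ℤ_[p] (g t) := (hint _).mpr (by rw [padicAbs_galois]; exact (hint _).mp hθM)
    let B := integralClosure ℤ_[p] M
    let t' : B := ⟨t, hθM⟩
    let y' : B := ⟨g t, hgt⟩ - t'
    -- The Taylor expansion is taken over the integers of `M`, so the coefficient `k` of the
    -- quadratic term is integral.
    obtain ⟨k, hk⟩ := (P.map (algebraMap ℤ_[p] B)).binomExpansion t' y'
    have hgP : g b = aeval (g t) P := by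
      rw [← hPb]
      exact ((aeval_algHom_apply ((g.restrictScalars ℚ_[p]).toAlgHom.restrictScalars ℤ_[p]) t P)).symm
    have hcoe : ∀ (Q : ℤ_[p][X]) (x : B),
        ((eval x (Q.map (algebraMap ℤ_[p] B)) : B) : M) = aeval (x : M) Q := fun Q x => by
      rw [eval_map_algebraMap]
      exact (aeval_algebraMap_apply M x Q).symm
    have hk' := congrArg (Subtype.val) hk
    rw [derivative_map] at hk'
    simp only [Subalgebra.coe_add, Subalgebra.coe_mul, Subalgebra.coe_pow, hcoe] at hk'
    have hy : (y' : M) = g t - t := rfl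
    have ht'' : (t' : M) = t := rfl
    rw [hy, ht'', add_sub_cancel, ← hgP, hPb] at hk'
    have : g b - b - aeval t (derivative P) * (g t - t) = k * (g t - t) ^ 2 := by
      rw [hk']
      ring
    rw [this, map_mul, map_pow]
    exact mul_le_of_le_one_left (by positivity) ((hint _).mp k.2)

/-- Traces in finite Galois extensions of deeply ramified fields are almost surjective on
integers. -/
theorem IsDeeplyRamified.exists_sum_galois_eq_one (hK : IsDeeplyRamified p K)
    [Algebra.IsAlgebraic ℚ_[p] M] [FiniteDimensional K M] [IsGalois K M] {c : ℝ} (hc : 1 < c) :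
    ∃ y : M, spectralNorm ℚ_[p] M y ≤ c ∧ ∑ g : Gal(M/K), g y = 1 :=
  exists_trace_eq_one (v := padicAbs p M) (isNonarchimedean_padicAbs p M) padicAbs_galois
    (fun _ hg _ hr => exists_integral_moved (isNonarchimedean_padicAbs p M) padicAbs_galois
      (fun b hb _ hε => hK.exists_small_slope b hb hε) hg hr) hc

end AlmostTrace

/-! ### Faces and products of sequences with an appended entry -/

section Fin

variable {G : Type*} [Group G] {n : ℕ}

theorem contractNth_last {α : Type*} (op : α → α → α) (s : Fin (n + 1) → α) :
    Fin.contractNth (Fin.last n) op s = fun i => s i.castSucc := by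
  ext i
  exact Fin.contractNth_apply_of_lt _ _ _ _ (by simp)

theorem contractNth_castSucc_snoc {α : Type*} (op : α → α → α) (j : Fin n) (s : Fin (n + 1) → α)
    (t : α) : Fin.contractNth j.castSucc.castSucc op (Fin.snoc s t : Fin (n + 2) → α) =
      Fin.snoc (Fin.contractNth j.castSucc op s) t := by
  ext i
  refine Fin.lastCases ?_ (fun i => ?_) i
  · rw [Fin.contractNth_apply_of_gt _ _ _ _ (by simp), Fin.succ_last, Fin.snoc_last, Fin.snoc_last]
  · rw [Fin.snoc_castSucc]
    rcases lt_trichotomy (i : ℕ) j with h | h | h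
    · rw [Fin.contractNth_apply_of_lt _ _ _ _ (by simpa using h),
        Fin.contractNth_apply_of_lt _ _ _ _ (by simpa using h), Fin.snoc_castSucc]
    · rw [Fin.contractNth_apply_of_eq _ _ _ _ (by simpa using h),
        Fin.contractNth_apply_of_eq _ _ _ _ (by simpa using h), Fin.snoc_castSucc,
        ← Fin.castSucc_succ, Fin.snoc_castSucc]
    · rw [Fin.contractNth_apply_of_gt _ _ _ _ (by simpa using h),
        Fin.contractNth_apply_of_gt _ _ _ _ (by simpa using h),
        ← Fin.castSucc_succ, Fin.snoc_castSucc]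

theorem contractNth_last_snoc {α : Type*} (op : α → α → α) (s : Fin (n + 1) → α) (t : α) :
    Fin.contractNth (Fin.last n).castSucc op (Fin.snoc s t : Fin (n + 2) → α) =
      Fin.snoc (fun i : Fin n => s i.castSucc) (op (s (Fin.last n)) t) := by
  ext i
  refine Fin.lastCases ?_ (fun i => ?_) i
  · rw [Fin.contractNth_apply_of_eq _ _ _ _ (by simp), Fin.succ_last, Fin.snoc_last, Fin.snoc_last,
      Fin.snoc_castSucc]
  · rw [Fin.contractNth_apply_of_lt _ _ _ _ (by simp), Fin.snoc_castSucc, Fin.snoc_castSucc]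

theorem tail_snoc {α : Type*} (s : Fin (n + 1) → α) (t : α) :
    (fun i : Fin (n + 1) => (Fin.snoc s t : Fin (n + 2) → α) i.succ) =
      Fin.snoc (fun i : Fin n => s i.succ) t := by
  ext i
  refine Fin.lastCases ?_ (fun i => ?_) i
  · rw [Fin.succ_last, Fin.snoc_last, Fin.snoc_last]
  · rw [← Fin.castSucc_succ, Fin.snoc_castSucc, Fin.snoc_castSucc]

/-- The ordered product of a finite sequence of group elements. -/
def seqProd (s : Fin n → G) : G := Fin.partialProd s (Fin.last n)

theorem seqProd_zero (s : Fin 0 → G) : seqProd s = 1 := Fin.partialProd_zero s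

theorem seqProd_succ (s : Fin (n + 1) → G) :
    seqProd s = seqProd (fun i : Fin n => s i.castSucc) * s (Fin.last n) := by
  rw [seqProd, ← Fin.succ_last, Fin.partialProd_succ, ← Fin.partialProd_init]
  rfl

theorem seqProd_succ' (s : Fin (n + 1) → G) :
    seqProd s = s 0 * seqProd (fun i : Fin n => s i.succ) := by
  rw [seqProd, ← Fin.succ_last, Fin.partialProd_succ']
  rfl

theorem seqProd_contractNth (j : Fin n) (s : Fin (n + 1) → G) :
    seqProd (Fin.contractNth j.castSucc (· * ·) s) = seqProd s := by
  rw [seqProd, seqProd, Fin.partialProd_contractNth, Function.comp_apply,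
    Fin.succAbove_ne_last_last]
  exact fun h => (Fin.castSucc_lt_last j).ne (Fin.succ_injective _ h)

end Fin

/-! ### The contracting homotopy -/

section Homotopy

variable {K M : Type u} [Field K] [Field M] [Algebra K M] {n : ℕ}

theorem twist_apply (χ : Gal(M/K) →* Kˣ) (s : Gal(M/K)) (x : M) :
    twist χ s x = (χ s : K) • s x := rfl

/-- Equivariance of the product of `M` with `M(χ)`; because of it, a trace-one element for the
untwisted action serves every `χ`. -/
theorem twist_mul (χ : Gal(M/K) →* Kˣ) (s : Gal(M/K)) (x y : M) :
    twist χ s (x * y) = s x * twist χ s y := by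
  rw [twist_apply, twist_apply, map_mul, mul_smul_comm]

theorem coboundary_apply (χ : Gal(M/K) →* Kˣ) (f : (Fin n → Gal(M/K)) → M)
    (s : Fin (n + 1) → Gal(M/K)) :
    coboundary χ n f s = twist χ (s 0) (f fun i => s i.succ) +
      ∑ j : Fin (n + 1), (-1 : K) ^ ((j : ℕ) + 1) • f (Fin.contractNth j (· * ·) s) := rfl

theorem coboundary_smul (χ : Gal(M/K) →* Kˣ) (a : K) (f : (Fin n → Gal(M/K)) → M) :
    coboundary χ n (a • f) = a • coboundary χ n f :=
  map_smul (inhomogeneousCochains.d (Rep.of (twist χ)) n).hom a f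

variable [FiniteDimensional K M]

/-- The homotopy `f ↦ y ∪ f` attached to an element `y` of trace one. -/
def contraction (y : M) (f : (Fin (n + 1) → Gal(M/K)) → M) (s : Fin n → Gal(M/K)) : M :=
  ∑ t : Gal(M/K), (seqProd s * t) y * f (Fin.snoc (α := fun _ => Gal(M/K)) s t)

theorem contraction_coboundary_zero (χ : Gal(M/K) →* Kˣ) {y : M} (hy : ∑ g : Gal(M/K), g y = 1)
    (f : (Fin 0 → Gal(M/K)) → M) :
    contraction y (coboundary χ 0 f) = coboundaryNegOne χ (y * f default) - f := by
  ext s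
  obtain ⟨m, rfl⟩ : ∃ m, f = fun _ => m :=
    ⟨f default, funext fun x => by rw [Subsingleton.elim x default]⟩
  simp only [contraction, seqProd_zero, one_mul, coboundary_apply, coboundaryNegOne, Pi.sub_apply,
    twist_mul]
  simp only [mul_add, Finset.sum_add_distrib, sub_eq_add_neg]
  congr 1
  simp [← Finset.sum_mul, hy]

/-- `y ∪ δ f = δ (y ∪ f) ± f` if `y` has trace one. -/
theorem contraction_coboundary (χ : Gal(M/K) →* Kˣ) {y : M} (hy : ∑ g : Gal(M/K), g y = 1)
    (f : (Fin (n + 1) → Gal(M/K)) → M) :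
    contraction y (coboundary χ (n + 1) f) =
      coboundary χ n (contraction y f) + (-1 : K) ^ n • f := by
  ext s
  have htr : ∑ t : Gal(M/K), (seqProd s * t) y = 1 := by
    rw [← hy]
    exact Fintype.sum_equiv (Equiv.mulLeft (seqProd s)) _ _ fun t => rfl
  -- The face multiplying the last entry of `s` by `t` becomes, after reindexing `t`, the last face
  -- of `δ(y ∪ f)`.
  have hlast : ∑ t : Gal(M/K), (seqProd s * t) y *
        f (Fin.snoc (α := fun _ => Gal(M/K)) (fun i : Fin n => s i.castSucc) (s (Fin.last n) * t)) =
      contraction y f fun i => s i.castSucc := by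
    rw [contraction]
    refine Fintype.sum_equiv (Equiv.mulLeft (s (Fin.last n))) _ _ fun t => ?_
    rw [seqProd_succ, mul_assoc]
    rfl
  have hfirst : ∑ t : Gal(M/K), (seqProd s * t) y *
        twist χ (s 0) (f (Fin.snoc (α := fun _ => Gal(M/K)) (fun i : Fin n => s i.succ) t)) =
      twist χ (s 0) (contraction y f fun i => s i.succ) := by
    rw [contraction, map_sum]
    refine Finset.sum_congr rfl fun t _ => ?_
    rw [twist_mul, seqProd_succ', mul_assoc]
    rfl
  have hmid : ∀ j : Fin n, ∑ t : Gal(M/K), (seqProd s * t) y * f (Fin.snoc (α := fun _ => Gal(M/K))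
        (Fin.contractNth j.castSucc (· * ·) s) t) =
      contraction y f (Fin.contractNth j.castSucc (· * ·) s) := fun j => by
    rw [contraction, seqProd_contractNth]
  rw [Pi.add_apply, Pi.smul_apply, coboundary_apply, contraction]
  have h0 : ∀ t, (Fin.snoc (α := fun _ => Gal(M/K)) s t : Fin (n + 2) → Gal(M/K)) 0 = s 0 :=
    fun t => by rw [← Fin.castSucc_zero, Fin.snoc_castSucc]
  simp_rw [coboundary_apply, h0, tail_snoc, Fin.sum_univ_castSucc, contractNth_last,
    Fin.snoc_castSucc, contractNth_castSucc_snoc, contractNth_last_snoc, mul_add, Finset.mul_sum,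
    Finset.sum_add_distrib, mul_smul_comm, hfirst, ← Finset.smul_sum, hlast, ← Finset.sum_mul, htr,
    one_mul]
  rw [Finset.sum_comm]
  simp_rw [← Finset.smul_sum, hmid]
  simp only [Fin.val_castSucc, Fin.val_last]
  -- The face that drops `t` carries the sign `(-1) ^ (n + 2)`, and its sum over `t` is `f s` times
  -- the trace of `y`.
  rw [pow_add (-1 : K) n 2]
  simp only [even_two, Even.neg_pow, one_pow, mul_one, ← add_assoc]

end Homotopy

/-! ### Norm bounds and cohomology -/

section Norm

variable (p : ℕ) [Fact p.Prime] {K M : Type u} [Field K] [Field M] [Algebra ℚ_[p] K]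
  [Algebra K M] [Algebra ℚ_[p] M] [IsScalarTower ℚ_[p] K M] [FiniteDimensional K M] {n : ℕ}

omit [IsScalarTower ℚ_[p] K M] [Algebra ℚ_[p] K] in
theorem le_cochainNorm (f : (Fin n → Gal(M/K)) → M) (s : Fin n → Gal(M/K)) :
    spectralNorm ℚ_[p] M (f s) ≤ cochainNorm p f :=
  le_ciSup (f := fun s => spectralNorm ℚ_[p] M (f s)) (Set.finite_range _).bddAbove s

omit [IsScalarTower ℚ_[p] K M] [Algebra ℚ_[p] K] [FiniteDimensional K M] in
theorem cochainNorm_nonneg (f : (Fin n → Gal(M/K)) → M) : 0 ≤ cochainNorm p f :=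
  Real.iSup_nonneg fun _ => spectralNorm_nonneg _

omit [IsScalarTower ℚ_[p] K M] [Algebra ℚ_[p] K] [FiniteDimensional K M] in
theorem cochainNorm_neg_one_pow_smul [Algebra.IsAlgebraic ℚ_[p] M] (k : ℕ)
    (f : (Fin n → Gal(M/K)) → M) : cochainNorm p ((-1 : K) ^ k • f) = cochainNorm p f := by
  refine congrArg iSup (funext fun s => ?_)
  change padicAbs p M ((-1 : K) ^ k • f s) = padicAbs p M (f s)
  rcases neg_one_pow_eq_or K k with h | h <;> simp [h]

theorem cochainNorm_contraction_le [Algebra.IsAlgebraic ℚ_[p] M] {y : M} {c : ℝ}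
    (hy : spectralNorm ℚ_[p] M y ≤ c) (f : (Fin (n + 1) → Gal(M/K)) → M) :
    cochainNorm p (contraction y f) ≤ c * cochainNorm p f := by
  have hc : 0 ≤ c := (spectralNorm_nonneg y).trans hy
  refine ciSup_le fun s => nonarch_sum_le (isNonarchimedean_padicAbs p M) _ _
    (mul_nonneg hc (cochainNorm_nonneg p f)) fun t _ => ?_
  rw [map_mul, padicAbs_galois]
  exact mul_le_mul hy (le_cochainNorm p f _) ((padicAbs p M).nonneg _) hc

variable {p} [IsGalois K M] [Algebra ℤ_[p] K] [IsScalarTower ℤ_[p] ℚ_[p] K]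

/-- Approximation of cochains of degree zero by coboundaries. -/
theorem IsDeeplyRamified.exists_approx_zero (hK : IsDeeplyRamified p K)
    [Algebra.IsAlgebraic ℚ_[p] M] (χ : Gal(M/K) →* Kˣ) {c : ℝ} (hc : 1 < c)
    (f : (Fin 0 → Gal(M/K)) → M) : ∃ g : M,
      cochainNorm p (f - coboundaryNegOne χ g) ≤ c * cochainNorm p (coboundary χ 0 f) ∧
        spectralNorm ℚ_[p] M g ≤ c * cochainNorm p f := by
  obtain ⟨y, hy, htr⟩ := hK.exists_sum_galois_eq_one (M := M) hc
  refine ⟨y * f default, ?_, ?_⟩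
  · have h : f - coboundaryNegOne χ (y * f default) =
        (-1 : K) ^ 1 • contraction y (coboundary χ 0 f) := by
      rw [contraction_coboundary_zero χ htr, pow_one, neg_one_smul, neg_sub]
    rw [h, cochainNorm_neg_one_pow_smul]
    exact cochainNorm_contraction_le p hy _
  · change padicAbs p M (y * f default) ≤ _
    rw [map_mul]
    exact mul_le_mul hy (le_cochainNorm p f _) ((padicAbs p M).nonneg _) (zero_le_one.trans hc.le)

/-- Approximation of cochains of positive degree by coboundaries. -/
theorem IsDeeplyRamified.exists_approx_succ (hK : IsDeeplyRamified p K)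
    [Algebra.IsAlgebraic ℚ_[p] M] (χ : Gal(M/K) →* Kˣ) {c : ℝ} (hc : 1 < c)
    (f : (Fin (n + 1) → Gal(M/K)) → M) : ∃ g : (Fin n → Gal(M/K)) → M,
      cochainNorm p (f - coboundary χ n g) ≤ c * cochainNorm p (coboundary χ (n + 1) f) ∧
        cochainNorm p g ≤ c * cochainNorm p f := by
  obtain ⟨y, hy, htr⟩ := hK.exists_sum_galois_eq_one (M := M) hc
  refine ⟨(-1 : K) ^ (n + 1) • contraction y f, ?_, ?_⟩
  · have h : f - coboundary χ n ((-1 : K) ^ (n + 1) • contraction y f) =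
        (-1 : K) ^ n • contraction y (coboundary χ (n + 1) f) := by
      rw [coboundary_smul, contraction_coboundary χ htr, smul_add, smul_smul, ← mul_pow, neg_one_mul,
        neg_neg, one_pow, one_smul, pow_succ, mul_neg_one, neg_smul, sub_neg_eq_add, add_comm f]
    rw [h, cochainNorm_neg_one_pow_smul]
    exact cochainNorm_contraction_le p hy _
  · rw [cochainNorm_neg_one_pow_smul]
    exact cochainNorm_contraction_le p hy _

omit [FiniteDimensional K M] [IsGalois K M] in
theorem mem_integralClosure_integers_iff [Algebra.IsAlgebraic ℚ_[p] M] {x : M} :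
    x ∈ integralClosure (integralClosure ℤ_[p] K) M ↔ spectralNorm ℚ_[p] M x ≤ 1 := by
  let _ : Algebra ℤ_[p] M := Algebra.compHom M (algebraMap ℤ_[p] ℚ_[p])
  have : IsScalarTower ℤ_[p] ℚ_[p] M := IsScalarTower.of_algebraMap_eq fun _ => rfl
  have : IsScalarTower ℤ_[p] (integralClosure ℤ_[p] K) M := by
    refine IsScalarTower.of_algebraMap_eq fun x => ?_
    change algebraMap ℚ_[p] M (algebraMap ℤ_[p] ℚ_[p] x) = algebraMap K M (algebraMap ℤ_[p] K x)
    rw [IsScalarTower.algebraMap_apply ℚ_[p] K M, ← IsScalarTower.algebraMap_apply ℤ_[p] ℚ_[p] K]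
  rw [← padicAbs_apply, ← isIntegral_iff_padicAbs_le_one]
  exact ⟨fun h => isIntegral_trans _ h, fun h => IsIntegral.tower_top h⟩

omit [Algebra ℚ_[p] M] [IsScalarTower ℚ_[p] K M] [IsGalois K M] [Algebra ℚ_[p] K]
  [IsScalarTower ℤ_[p] ℚ_[p] K] in
-- Allows the approximation over `K` to be applied to cocycles with values in `𝒪_M(χ)`, whose
-- complex is linear over the integers of `K`.
theorem coe_d_integralTwist (χ : Gal(M/K) →* Kˣ)
    (f : (Fin n → Gal(M/K)) → integralClosure (integralClosure ℤ_[p] K) M)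
    (s : Fin (n + 1) → Gal(M/K)) :
    (((inhomogeneousCochains.d (Rep.of (integralTwist (integralClosure ℤ_[p] K) χ)) n).hom f s :
      integralClosure (integralClosure ℤ_[p] K) M) : M) = coboundary χ n (fun t => (f t : M)) s := by
  have hsign : ∀ (k : ℕ) (x : integralClosure (integralClosure ℤ_[p] K) M),
      (((-1 : integralClosure ℤ_[p] K) ^ k • x : integralClosure (integralClosure ℤ_[p] K) M) : M) =
        (-1 : K) ^ k • (x : M) := by
    intro k x
    rcases Nat.even_or_odd k with h | h <;> simp [h.neg_one_pow]
  rw [coboundary_apply]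
  change ((integralTwist (integralClosure ℤ_[p] K) χ (s 0) (f fun i => s i.succ) +
    ∑ j : Fin (n + 1), (-1 : integralClosure ℤ_[p] K) ^ ((j : ℕ) + 1) •
      f (Fin.contractNth j (· * ·) s) : integralClosure (integralClosure ℤ_[p] K) M) : M) = _
  rw [Subalgebra.coe_add, AddSubmonoidClass.coe_finsetSum]
  simp_rw [hsign]
  rfl

/-- The cohomology of the integers is killed by `p`. -/
theorem IsDeeplyRamified.prime_smul_eq_zero (hK : IsDeeplyRamified p K)
    [Algebra.IsAlgebraic ℚ_[p] M] (χ : Gal(M/K) →* Kˣ)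
    (x : groupCohomology (Rep.of (integralTwist (integralClosure ℤ_[p] K) χ)) (n + 1)) :
    p • x = 0 := by
  let R := Rep.of (integralTwist (integralClosure ℤ_[p] K) χ)
  induction x using groupCohomology_induction_on with
  | h z =>
  let f : (Fin (n + 1) → Gal(M/K)) → integralClosure (integralClosure ℤ_[p] K) M :=
    groupCohomology.iCocycles R (n + 1) z
  have hdf : (inhomogeneousCochains.d R (n + 1)).hom f = 0 := by
    have h := (groupCohomology.inhomogeneousCochains R).iCycles_d (n + 1) (n + 2)
    rw [groupCohomology.inhomogeneousCochains.d_def] at h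
    exact congrArg (fun φ => φ.hom z) h
  have hp1 : (1 : ℝ) < p := by exact_mod_cast (Fact.out : p.Prime).one_lt
  have hp0 : (0 : ℝ) < p := zero_lt_one.trans hp1
  have hF1 : cochainNorm p (fun s => (f s : M)) ≤ 1 :=
    ciSup_le fun s => mem_integralClosure_integers_iff.mp (f s).2
  have hdF : coboundary χ (n + 1) (fun s => (f s : M)) = 0 := by
    funext s
    rw [← coe_d_integralTwist, hdf]
    rfl
  -- The constant `c = p` is allowed since `p > 1`, and multiplication by `p` exactly compensates it
  -- in `hgint`.
  obtain ⟨g, hg, hgn⟩ := hK.exists_approx_succ χ hp1 fun s => (f s : M)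
  have hzero : ∀ s, (f s : M) = coboundary χ n g s := by
    intro s
    have h0 : cochainNorm p (coboundary χ (n + 1) (fun s => (f s : M))) ≤ 0 := by
      rw [hdF]
      refine ciSup_le fun s => ?_
      rw [Pi.zero_apply, spectralNorm_zero]
    have h1 := (le_cochainNorm p _ s).trans (hg.trans (mul_nonpos_of_nonneg_of_nonpos hp0.le h0))
    have h2 := (padicAbs p M).eq_zero.mp (le_antisymm h1 (spectralNorm_nonneg _))
    exact sub_eq_zero.mp h2
  have hgint : ∀ s, ((p : K) • g) s ∈ integralClosure (integralClosure ℤ_[p] K) M := by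
    intro s
    rw [mem_integralClosure_integers_iff, Pi.smul_apply, Algebra.smul_def, map_natCast]
    change padicAbs p M _ ≤ 1
    rw [map_mul, padicAbs_natCast, inv_mul_le_one₀ hp0]
    refine (le_cochainNorm p g s).trans (hgn.trans ?_)
    exact mul_le_of_le_one_right hp0.le hF1
  let g' : (Fin n → Gal(M/K)) → integralClosure (integralClosure ℤ_[p] K) M :=
    fun s => ⟨_, hgint s⟩
  have hdg : (inhomogeneousCochains.d R n).hom g' = p • f := by
    funext s
    refine Subtype.ext ?_
    rw [coe_d_integralTwist]
    change coboundary χ n ((p : K) • g) s = _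
    rw [coboundary_smul, Pi.smul_apply, ← hzero, Pi.smul_apply, Nat.cast_smul_eq_nsmul]
    rfl
  have hz : p • z = (groupCohomology.toCocycles R n (n + 1)).hom g' := by
    refine (ModuleCat.mono_iff_injective (groupCohomology.iCocycles R (n + 1))).mp inferInstance ?_
    rw [map_nsmul]
    refine hdg.symm.trans ?_
    have h := (groupCohomology.inhomogeneousCochains R).toCycles_i n (n + 1)
    rw [groupCohomology.inhomogeneousCochains.d_def] at h
    exact (congrArg (fun φ => φ.hom g') h).symm
  rw [← map_nsmul, hz]
  exact congrArg (fun φ => φ.hom g')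
    ((groupCohomology.inhomogeneousCochains R).toCycles_comp_homologyπ n (n + 1))

end Norm

end DeeplyRamified

end

theorem lemma6 (p : ℕ) [Fact p.Prime] (K M : Type u) [Field K] [Field M]
    [Algebra ℚ_[p] K] [Algebra ℤ_[p] K] [IsScalarTower ℤ_[p] ℚ_[p] K]
    [Algebra K M] [Algebra ℚ_[p] M] [IsScalarTower ℚ_[p] K M]
    [FiniteDimensional K M] [IsGalois K M]
    (hK : DeeplyRamified.IsDeeplyRamified p K) (χ : Gal(M/K) →* Kˣ) :
    (∀ c : ℝ, 1 < c →
      (∀ f : (Fin 0 → Gal(M/K)) → M, ∃ g : M,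
        DeeplyRamified.cochainNorm p (f - DeeplyRamified.coboundaryNegOne χ g)
            ≤ c * DeeplyRamified.cochainNorm p (DeeplyRamified.coboundary χ 0 f) ∧
          spectralNorm ℚ_[p] M g ≤ c * DeeplyRamified.cochainNorm p f) ∧
      (∀ (n : ℕ) (f : (Fin (n + 1) → Gal(M/K)) → M), ∃ g : (Fin n → Gal(M/K)) → M,
        DeeplyRamified.cochainNorm p (f - DeeplyRamified.coboundary χ n g)
            ≤ c * DeeplyRamified.cochainNorm p (DeeplyRamified.coboundary χ (n + 1) f) ∧
          DeeplyRamified.cochainNorm p g ≤ c * DeeplyRamified.cochainNorm p f)) ∧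
    (∀ q : ℕ, 0 < q →
      ∀ x : groupCohomology
          (Rep.of (DeeplyRamified.integralTwist (integralClosure ℤ_[p] K) χ)) q,
        p • x = 0) := by
  have : Algebra.IsAlgebraic ℚ_[p] K := hK.1
  have : Algebra.IsAlgebraic ℚ_[p] M := Algebra.IsAlgebraic.trans ℚ_[p] K M
  refine ⟨fun c hc => ⟨fun f => hK.exists_approx_zero χ hc f,
    fun n f => hK.exists_approx_succ χ hc f⟩, fun q hq x => ?_⟩
  obtain ⟨n, rfl⟩ := Nat.exists_eq_succ_of_ne_zero hq.ne'
  exact hK.prime_smul_eq_zero χ x
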